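/- For an integer $n$ let $BS(1,n)=\langle a,b\mid ab=ba^n\rangle$ be the Baumslag–Solitar group, and for a finite set $A\subseteq\mathbb Z$ write $ba^A=\{ba^x : x\in A\}\subseteq BS(1,n)$. For a subset $S$ of a group, $S^2=\{st : s,t\in S\}$, and $|\cdot|$ denotes cardinality. Theorem. Let $A\subseteq\mathbb Z$ be a finite set of integers. (a) If $S=ba^A\subseteq BS(1,2)$, then $|S^2|\ge 3|S|-2$. Moreover, equality holds if and only if $A$ is a (nonempty) arithmetic progression, i.e. $A=\{a_0,a_0+d,\dots,a_0+(k-1)d\}$ for some integers $a_0$, $d\neq 0$ and $k\ge 1$. (b) If $S=ba^A\subseteq BS(1,3)$, then $|S^2|\ge 4|S|-4$. Moreover, equality holds if and only if $A=\{cx+e : x\in B\}$ for some integers $c\ne 0$ and $e$, where $B$ is one of the sets $\{0,1,3\}$, $\{0,1,4\}$, or $\{3i : 0\le i\le n\}\cup\{3i+1 : 0\le i\le n\}$ for some integer $n\ge 0$. -/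

import Mathlib

open scoped Pointwise

/-- The defining relator `b⁻¹ a ^ m b a ^ (-n)` of the Baumslag-Solitar group `BS(m, n)`, in the
free group on the two letters `a` (the letter `0`) and `b` (the letter `1`). -/
def bsRelator (m n : ℤ) : FreeGroup (Fin 2) :=
  (FreeGroup.of 1)⁻¹ * FreeGroup.of 0 ^ m * FreeGroup.of 1 * (FreeGroup.of 0 ^ n)⁻¹

/-- The Baumslag-Solitar group `BS(m, n) = ⟨a, b ∣ a ^ m b = b a ^ n⟩`. -/
abbrev BS (m n : ℤ) : Type := PresentedGroup ({bsRelator m n} : Set (FreeGroup (Fin 2)))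

/-- The generator `a` of `BS(m, n)`. -/
def BS.a (m n : ℤ) : BS m n := PresentedGroup.of 0

/-- The generator `b` of `BS(m, n)`. -/
def BS.b (m n : ℤ) : BS m n := PresentedGroup.of 1

/-- The subset `b a ^ A = {b a ^ x : x ∈ A}` of `BS(m, n)`. -/
def BS.bPowSet (m n : ℤ) (A : Finset ℤ) : Set (BS m n) :=
  {g | ∃ x ∈ A, g = BS.b m n * BS.a m n ^ x}

/-- `A` is an arithmetic progression `{a₀, a₀ + d, …, a₀ + (k - 1) d}` with `k ≥ 1` terms and
nonzero difference `d`. -/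
def IsArithProg (A : Finset ℤ) : Prop :=
  ∃ (a₀ d : ℤ) (k : ℕ), d ≠ 0 ∧ 1 ≤ k ∧
    A = (Finset.range k).image (fun i : ℕ => a₀ + (i : ℤ) * d)

/-- `A` is the image of `B` under a nondegenerate affine map `x ↦ c x + e` (the identity map being
allowed). -/
def IsAffineTransform (A B : Finset ℤ) : Prop :=
  ∃ c e : ℤ, c ≠ 0 ∧ A = B.image (fun x => c * x + e)

/-- The set `3 ∗ {0, …, n} ∪ (3 ∗ {0, …, n} + 1)`. -/
def threeDilateUnion (n : ℕ) : Finset ℤ :=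
  (Finset.range (n + 1)).image (fun i : ℕ => 3 * (i : ℤ)) ∪
    (Finset.range (n + 1)).image (fun i : ℕ => 3 * (i : ℤ) + 1)

/-! Since a b = b a^n, one has (b a^x)(b a^y) = b² a^(y + n x); as a has infinite order, |S| = |A|
and |S²| = |A + n∗A|. Affine maps do not change this cardinality, so for |A| ≥ 2 the set may be
taken to meet at least two classes modulo n. Summands from distinct classes give sums in distinct
classes, and each class is bounded by |U + V| ≥ |U| + |V| - 1.

For n = 2 the two classes give 3|A| - 2 at once. In case of equality, a class U with at least two
elements makes U + 2∗A tight, which forces 2∗A to be a progression (`exists_forall_eq_arithProg`).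

For n = 3 a set B meeting all three classes has |B + 3∗B| ≥ 4|B| - 3. Otherwise, after a
translation, B = 3∗X ∪ (3∗Y + 1), and |B + 3∗B| = |X + B| + |Y + B|. Induction gives |X + 3∗X| ≥
4|X| - 4, and the sums X + (3∗Y + 1), which lie in shifted classes, improve on it
(`card_add_interleave_bounds`); a reflection turns |Y + B| into a quantity of the same kind.
Equality leaves only |B| ≤ 3 or |X| = |Y| ≥ 2 with |X + B| ≤ 4|X| - 2. The latter makes X a
progression of difference d and 3∗Y + 1 = 3∗X ± d (`isShiftedProg_of_card_le`), which is the
infinite family. -/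

namespace BaumslagSolitar

/-! ### From products in BS(1, n) to sums of dilates -/

/-- The affine action of `BS(1, n)` on `ℚ`, where `a` acts by `t ↦ t + 1` and `b` by `t ↦ t / n`. -/
def affineGen (n : ℤ) (hn : (n : ℚ) ≠ 0) : Fin 2 → Equiv.Perm ℚ :=
  ![Equiv.addRight 1, (Equiv.mulRight₀ (n : ℚ) hn)⁻¹]

theorem addRight_one_zpow (x : ℤ) (t : ℚ) :
    ((Equiv.addRight (1 : ℚ)) ^ x) t = t + x := by
  induction x generalizing t with
  | zero => simp
  | succ n ih => rw [zpow_add_one, Equiv.Perm.mul_apply, ih, Equiv.coe_addRight]; push_cast; ring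
  | pred n ih =>
    rw [zpow_sub_one, Equiv.Perm.mul_apply, ih, Equiv.Perm.inv_def, Equiv.addRight_symm,
      Equiv.coe_addRight]
    push_cast
    ring

theorem lift_affineGen_eq_one (n : ℤ) (hn : (n : ℚ) ≠ 0) :
    ∀ r ∈ ({bsRelator 1 n} : Set (FreeGroup (Fin 2))), FreeGroup.lift (affineGen n hn) r = 1 := by
  rintro r rfl
  simp only [bsRelator, map_mul, map_inv, map_zpow, FreeGroup.lift_apply_of]
  rw [mul_inv_eq_one]
  ext t
  simp only [affineGen, Matrix.cons_val_zero, Matrix.cons_val_one, inv_inv, Equiv.Perm.mul_apply,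
    addRight_one_zpow, zpow_one]
  have : ((Equiv.mulRight₀ (n : ℚ) hn)⁻¹ : Equiv.Perm ℚ) t = t * (n : ℚ)⁻¹ := rfl
  rw [this]
  simp only [Equiv.mulRight₀_apply, Equiv.coe_addRight]
  field_simp

/-- In the affine action a^x sends 0 to x, so distinct powers of a differ. -/
theorem a_zpow_injective (n : ℤ) (hn : n ≠ 0) :
    Function.Injective fun x : ℤ => BS.a 1 n ^ x := by
  intro x y hxy
  have hn' : (n : ℚ) ≠ 0 := by exact_mod_cast hn
  have h := congrArg (PresentedGroup.toGroup (lift_affineGen_eq_one n hn')) hxy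
  simp only [map_zpow, BS.a, PresentedGroup.toGroup.of] at h
  have h0 := congrArg (fun f : Equiv.Perm ℚ => f 0) h
  simp only [affineGen, Matrix.cons_val_zero, addRight_one_zpow, zero_add] at h0
  exact_mod_cast h0

theorem a_mul_b (n : ℤ) : BS.a 1 n * BS.b 1 n = BS.b 1 n * BS.a 1 n ^ n := by
  have h : (BS.b 1 n)⁻¹ * BS.a 1 n ^ (1 : ℤ) * BS.b 1 n * (BS.a 1 n ^ n)⁻¹ = 1 :=
    PresentedGroup.one_of_mem (Set.mem_singleton (bsRelator 1 n))
  rw [mul_inv_eq_one, mul_assoc, inv_mul_eq_iff_eq_mul, zpow_one] at h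
  exact h

theorem a_zpow_mul_b (n x : ℤ) :
    BS.a 1 n ^ x * BS.b 1 n = BS.b 1 n * BS.a 1 n ^ (n * x) := by
  have h : SemiconjBy (BS.b 1 n) (BS.a 1 n ^ n) (BS.a 1 n) := (a_mul_b n).symm
  rw [zpow_mul]
  exact (h.zpow_right x).eq.symm

/-- The sum `A + n ∗ A` of `A` with its dilate by `n`. -/
def sumDilate (n : ℤ) (A : Finset ℤ) : Finset ℤ := A + A.image (n * ·)

theorem mem_sumDilate {n : ℤ} {A : Finset ℤ} {z : ℤ} :
    z ∈ sumDilate n A ↔ ∃ x ∈ A, ∃ y ∈ A, x + n * y = z := by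
  simp [sumDilate, Finset.mem_add]

theorem ncard_bPowSet (n : ℤ) (hn : n ≠ 0) (A : Finset ℤ) :
    (BS.bPowSet 1 n A).ncard = A.card := by
  have h : BS.bPowSet 1 n A = (fun x : ℤ => BS.b 1 n * BS.a 1 n ^ x) '' (A : Set ℤ) := by
    ext g
    simp [BS.bPowSet, eq_comm]
  rw [h, Set.ncard_image_of_injective, Set.ncard_coe_finset]
  exact (mul_right_injective _).comp (a_zpow_injective n hn)

theorem ncard_bPowSet_mul_self (n : ℤ) (hn : n ≠ 0) (A : Finset ℤ) :
    (BS.bPowSet 1 n A * BS.bPowSet 1 n A).ncard = (sumDilate n A).card := by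
  have key (x y : ℤ) : BS.b 1 n * BS.a 1 n ^ x * (BS.b 1 n * BS.a 1 n ^ y) =
      BS.b 1 n * BS.b 1 n * BS.a 1 n ^ (y + n * x) := by
    rw [add_comm, zpow_add, mul_assoc (BS.b 1 n) (BS.a 1 n ^ x), ← mul_assoc (BS.a 1 n ^ x),
      a_zpow_mul_b]
    simp only [mul_assoc]
  have h : BS.bPowSet 1 n A * BS.bPowSet 1 n A =
      (fun x : ℤ => BS.b 1 n * BS.b 1 n * BS.a 1 n ^ x) '' (sumDilate n A : Set ℤ) := by
    ext g
    simp only [Set.mem_mul, BS.bPowSet, Set.mem_ofPred_eq, Set.mem_image, Finset.mem_coe,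
      mem_sumDilate]
    constructor
    · rintro ⟨_, ⟨x, hx, rfl⟩, _, ⟨y, hy, rfl⟩, rfl⟩
      exact ⟨_, ⟨y, hy, x, hx, rfl⟩, (key x y).symm⟩
    · rintro ⟨_, ⟨y, hy, x, hx, rfl⟩, rfl⟩
      exact ⟨_, ⟨x, hx, rfl⟩, _, ⟨y, hy, rfl⟩, key x y⟩
  rw [h, Set.ncard_image_of_injective, Set.ncard_coe_finset]
  exact (mul_right_injective _).comp (a_zpow_injective n hn)

/-! ### Affine invariance and normalisation -/

theorem card_sumDilate_image_affine (n : ℤ) {c : ℤ} (hc : c ≠ 0) (e : ℤ) (A : Finset ℤ) :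
    (sumDilate n (A.image fun x => c * x + e)).card = (sumDilate n A).card := by
  have h : sumDilate n (A.image fun x => c * x + e) =
      (sumDilate n A).image fun z => c * z + (e + n * e) := by
    ext z
    simp only [mem_sumDilate, Finset.mem_image]
    constructor
    · rintro ⟨_, ⟨x, hx, rfl⟩, _, ⟨y, hy, rfl⟩, rfl⟩
      exact ⟨_, ⟨x, hx, y, hy, rfl⟩, by ring⟩
    · rintro ⟨_, ⟨x, hx, y, hy, rfl⟩, rfl⟩
      exact ⟨_, ⟨x, hx, rfl⟩, _, ⟨y, hy, rfl⟩, by ring⟩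
  rw [h, Finset.card_image_of_injective]
  intro x y hxy
  simpa [hc] using hxy

theorem card_image_affine {c : ℤ} (hc : c ≠ 0) (e : ℤ) (A : Finset ℤ) :
    (A.image fun x => c * x + e).card = A.card := by
  apply Finset.card_image_of_injective
  intro x y hxy
  simpa [hc] using hxy

/-- A finite set of at least two integers is an affine image of a set that is not contained in a
single residue class modulo `n`. -/
theorem exists_affine_not_dvd_sub {n : ℤ} (hn : ¬ IsUnit n) {A : Finset ℤ} (hA : 2 ≤ A.card) :
    ∃ (c e : ℤ) (B : Finset ℤ), c ≠ 0 ∧ A = B.image (fun x => c * x + e) ∧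
      ∃ x ∈ B, ∃ y ∈ B, ¬ n ∣ x - y := by
  obtain ⟨p, hp, q, hq, hpq⟩ := Finset.one_lt_card.1 hA
  -- Translate p to 0 and divide by the gcd of the differences: the quotients have gcd 1, so a
  -- nonunit n cannot divide them all.
  obtain ⟨g, hg, hg1⟩ := Finset.extract_gcd (fun x => x - p) ⟨p, hp⟩
  set c := A.gcd (fun x => x - p) with hc
  have hc0 : c ≠ 0 := by
    rw [hc, Ne, Finset.gcd_eq_zero_iff]
    intro h
    exact hpq (sub_eq_zero.1 (h q hq)).symm
  have hgp : g p = 0 := by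
    have := hg p hp
    simpa [hc0] using this
  refine ⟨c, p, A.image g, hc0, ?_, ?_⟩
  · rw [Finset.image_image]
    conv_lhs => rw [← Finset.image_id (s := A)]
    apply Finset.image_congr
    intro x hx
    have := hg x hx
    simp only [id, Function.comp]
    linarith
  · by_contra! h
    apply hn
    apply isUnit_of_dvd_one
    rw [← hg1]
    apply Finset.dvd_gcd
    intro b hb
    have := h _ (Finset.mem_image_of_mem g hb) _ (Finset.mem_image_of_mem g hp)
    simpa [hgp] using this

/-! ### Sums of two sets of integers and the case of equality -/

theorem card_add_card_le {X Y : Finset ℤ} (hX : X.Nonempty) (hY : Y.Nonempty) :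
    X.card + Y.card ≤ (X + Y).card + 1 := by
  have := cauchy_davenport_add_of_linearOrder_isCancelAdd hX hY
  omega

/-- The arithmetic progression with first term `p`, difference `d` and `k` terms. -/
def arithProg (p d : ℤ) (k : ℕ) : Finset ℤ := (Finset.range k).image fun i : ℕ => p + (i : ℤ) * d

theorem mem_arithProg {p d z : ℤ} {k : ℕ} :
    z ∈ arithProg p d k ↔ ∃ i < k, p + (i : ℤ) * d = z := by
  simp [arithProg]

theorem card_arithProg (p : ℤ) {d : ℤ} (hd : d ≠ 0) (k : ℕ) : (arithProg p d k).card = k := by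
  rw [arithProg, Finset.card_image_of_injective, Finset.card_range]
  intro i j hij
  simpa [hd] using hij

/-- If `V + δ` has at most one element outside of `V`, then `V` is an arithmetic progression with
difference `δ`. -/
theorem eq_arithProg_of_card_union_le {V : Finset ℤ} (hV : V.Nonempty) {δ : ℤ} (hδ : 0 < δ)
    (h : (V ∪ V.image (· + δ)).card ≤ V.card + 1) : ∃ p, V = arithProg p δ V.card := by
  set M := V.max' hV with hM
  have hMV : M ∈ V := V.max'_mem hV
  have hMδ : M + δ ∉ V := fun h' => by
    have := V.le_max' _ h'
    omega
  -- The element M + δ already uses up the one permitted new element.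
  have step : ∀ v ∈ V, v ≠ M → v + δ ∈ V := by
    intro v hv hvM
    by_contra hvδ
    have hsub : insert (v + δ) (insert (M + δ) V) ⊆ V ∪ V.image (· + δ) := by
      intro z
      simp only [Finset.mem_insert, Finset.mem_union, Finset.mem_image]
      rintro (rfl | rfl | hz)
      · exact Or.inr ⟨v, hv, rfl⟩
      · exact Or.inr ⟨M, hMV, rfl⟩
      · exact Or.inl hz
    have := Finset.card_le_card hsub
    rw [Finset.card_insert_of_notMem, Finset.card_insert_of_notMem hMδ] at this
    · omega
    · simp [hvδ, hvM]
  have chain : ∀ (m : ℕ) (v : ℤ), v ∈ V → (M - v).toNat = m → ∃ k : ℕ, M = v + k * δ := by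
    intro m
    induction m using Nat.strong_induction_on with
    | _ m ih =>
      intro v hv hvm
      by_cases hvM : v = M
      · exact ⟨0, by simp [hvM]⟩
      · have h1 := step v hv hvM
        have h2 := V.le_max' _ h1
        obtain ⟨k, hk⟩ := ih (M - (v + δ)).toNat (by omega) _ h1 rfl
        exact ⟨k + 1, by rw [hk]; push_cast; ring⟩
  set m := V.min' hV with hm
  have hmV : m ∈ V := V.min'_mem hV
  obtain ⟨K, hK⟩ := chain _ m hmV rfl
  have up : ∀ i : ℕ, i ≤ K → m + i * δ ∈ V := by
    intro i
    induction i with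
    | zero => intro _; simpa using hmV
    | succ i ih =>
      intro hi
      have h1 := step _ (ih (by omega)) (by
        intro h2
        rw [hK] at h2
        have h3 : (i : ℤ) * δ = K * δ := by linarith
        have := mul_right_cancel₀ hδ.ne' h3
        omega)
      have : m + ((i + 1 : ℕ) : ℤ) * δ = m + i * δ + δ := by push_cast; ring
      rwa [this]
  have hVeq : V = arithProg m δ (K + 1) := by
    ext v
    rw [mem_arithProg]
    constructor
    · intro hv
      obtain ⟨k, hk⟩ := chain _ v hv rfl
      have h1 : m ≤ v := V.min'_le _ hv
      have hkK : k ≤ K := by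
        have : (k : ℤ) * δ ≤ K * δ := by linarith
        have := le_of_mul_le_mul_right this hδ
        omega
      refine ⟨K - k, by omega, ?_⟩
      push_cast [hkK]
      linarith
    · rintro ⟨i, hi, rfl⟩
      exact up i (by omega)
  refine ⟨m, ?_⟩
  have hc : V.card = K + 1 := by
    conv_lhs => rw [hVeq]
    exact card_arithProg _ hδ.ne' _
  rw [hc]
  exact hVeq

/-- The case of equality in `|U + V| ≥ |U| + |V| - 1`: the difference of the progression `V` is the
difference of the two smallest elements of `U`. -/
theorem exists_forall_eq_arithProg {U : Finset ℤ} (hU : 2 ≤ U.card) :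
    ∃ u ∈ U, ∃ u' ∈ U, u < u' ∧ ∀ V : Finset ℤ, V.Nonempty →
      (U + V).card + 1 ≤ U.card + V.card → ∃ p, V = arithProg p (u' - u) V.card := by
  have hU0 : U.Nonempty := Finset.card_pos.1 (by omega)
  set u := U.min' hU0
  have huU : u ∈ U := U.min'_mem hU0
  have hU1 : (U.erase u).Nonempty := Finset.card_pos.1 (by
    rw [Finset.card_erase_of_mem huU]; omega)
  set u' := (U.erase u).min' hU1
  have hu'U : u' ∈ U.erase u := (U.erase u).min'_mem hU1
  have hlt : u < u' := lt_of_le_of_ne (U.min'_le _ (Finset.mem_of_mem_erase hu'U))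
    (Finset.ne_of_mem_erase hu'U).symm
  refine ⟨u, huU, u', Finset.mem_of_mem_erase hu'U, hlt, fun V hV h => ?_⟩
  apply eq_arithProg_of_card_union_le hV (by omega)
  set M := V.max' hV
  have hMV : M ∈ V := V.max'_mem hV
  -- The |U| - 2 sums t + M with t > u' exceed all of {u, u'} + V, so tightness leaves at most |V| +
  -- 1 elements for {u, u'} + V.
  set T := ((U.erase u).erase u').image (· + M)
  have hT : T.card = U.card - 2 := by
    rw [Finset.card_image_of_injective _ (add_left_injective M), Finset.card_erase_of_mem hu'U,
      Finset.card_erase_of_mem huU]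
    omega
  set W := (V ∪ V.image (· + (u' - u))).image (· + u)
  have hW : W.card = (V ∪ V.image (· + (u' - u))).card :=
    Finset.card_image_of_injective _ (add_left_injective u)
  have hdisj : Disjoint W T := by
    rw [Finset.disjoint_left]
    intro z hz hz'
    simp only [W, T, Finset.mem_image, Finset.mem_union] at hz hz'
    obtain ⟨t, ht, rfl⟩ := hz'
    have h1 : u' ≤ t := (U.erase u).min'_le _ (Finset.mem_of_mem_erase ht)
    have h2 : t ≠ u' := Finset.ne_of_mem_erase ht
    obtain ⟨v, hv, hvz⟩ := hz
    rcases hv with hv | ⟨w, hw, rfl⟩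
    · have := V.le_max' _ hv
      omega
    · have := V.le_max' _ hw
      omega
  have hsub : W ∪ T ⊆ U + V := by
    intro z hz
    simp only [W, T, Finset.mem_image, Finset.mem_union] at hz
    rw [Finset.mem_add]
    rcases hz with ⟨v, hv | ⟨w, hw, rfl⟩, rfl⟩ | ⟨t, ht, rfl⟩
    · exact ⟨u, huU, v, hv, by ring⟩
    · exact ⟨u', Finset.mem_of_mem_erase hu'U, w, hw, by ring⟩
    · exact ⟨t, Finset.mem_of_mem_erase (Finset.mem_of_mem_erase ht), M, hMV, rfl⟩
  have := Finset.card_le_card hsub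
  rw [Finset.card_union_of_disjoint hdisj, hT, hW] at this
  omega

theorem arithProg_image_affine (p d c e : ℤ) (k : ℕ) :
    (arithProg p d k).image (fun x => c * x + e) = arithProg (c * p + e) (c * d) k := by
  ext z
  simp only [Finset.mem_image, mem_arithProg]
  constructor
  · rintro ⟨_, ⟨i, hi, rfl⟩, rfl⟩
    exact ⟨i, hi, by ring⟩
  · rintro ⟨i, hi, rfl⟩
    exact ⟨_, ⟨i, hi, rfl⟩, by ring⟩

theorem eq_arithProg_of_image_affine {X : Finset ℤ} (hX : X.Nonempty) {c e p d : ℤ} (hc : c ≠ 0)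
    (h : X.image (fun x => c * x + e) = arithProg p (c * d) X.card) :
    ∃ q, X = arithProg q d X.card := by
  have hinj : Function.Injective fun x : ℤ => c * x + e := fun x y hxy => by
    simpa [hc] using hxy
  have hp : p ∈ X.image (fun x => c * x + e) := by
    rw [h, mem_arithProg]
    exact ⟨0, Finset.card_pos.2 hX, by simp⟩
  obtain ⟨q, -, hq⟩ := Finset.mem_image.1 hp
  refine ⟨q, ?_⟩
  apply Finset.image_injective hinj
  rw [arithProg_image_affine, h, ← hq]

theorem pair_eq_arithProg (x y : ℤ) : ({x, y} : Finset ℤ) = arithProg x (y - x) 2 := by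
  simp [arithProg, Finset.range_add_one, Finset.pair_comm]

theorem dvd_sub_sub {n x y r : ℤ} (hx : n ∣ x - r) (hy : n ∣ y - r) : n ∣ y - x := by
  have := dvd_sub hy hx
  rwa [sub_sub_sub_cancel_right] at this

/-! ### The case n = 2 -/

theorem sumDilate_two_of_not_dvd_sub {B : Finset ℤ} (hB : ∃ x ∈ B, ∃ y ∈ B, ¬ (2 : ℤ) ∣ x - y) :
    3 * B.card ≤ (sumDilate 2 B).card + 2 ∧
      ((sumDilate 2 B).card + 2 ≤ 3 * B.card → ∃ p d, d ≠ 0 ∧ B = arithProg p d B.card) := by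
  obtain ⟨x, hx, y, hy, hxy⟩ := hB
  set V := B.image ((2 : ℤ) * ·) with hV
  have hVc : V.card = B.card :=
    Finset.card_image_of_injective _ (mul_right_injective₀ two_ne_zero)
  set U₁ := B.filter fun z => (2 : ℤ) ∣ z - x with hU₁
  set U₂ := B.filter fun z => ¬ (2 : ℤ) ∣ z - x with hU₂
  have hUc : U₁.card + U₂.card = B.card := Finset.card_filter_add_card_filter_not _
  have h1 : U₁.Nonempty := ⟨x, by simp [hU₁, hx]⟩
  have h2 : U₂.Nonempty := ⟨y, by simp only [hU₂, Finset.mem_filter]; exact ⟨hy, by omega⟩⟩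
  have hVn : V.Nonempty := ⟨_, Finset.mem_image_of_mem _ hx⟩
  -- Elements of V are even, so U₁ + V and U₂ + V have opposite parities.
  have hsum : (sumDilate 2 B).card = (U₁ + V).card + (U₂ + V).card := by
    rw [← Finset.card_union_of_disjoint, ← Finset.union_add, hU₁, hU₂,
      Finset.filter_union_filter_not_eq]
    · rfl
    · rw [Finset.disjoint_left]
      intro z hz hz'
      simp only [Finset.mem_add, hU₁, hU₂, hV, Finset.mem_filter, Finset.mem_image] at hz hz'
      obtain ⟨a, ⟨-, ha⟩, _, ⟨b, -, rfl⟩, rfl⟩ := hz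
      obtain ⟨a', ⟨-, ha'⟩, _, ⟨b', -, rfl⟩, h⟩ := hz'
      omega
  have c1 := card_add_card_le h1 hVn
  have c2 := card_add_card_le h2 hVn
  refine ⟨by omega, fun hle => ?_⟩
  -- Inside one parity class the difference u' - u is some 2 d, so the progression V = 2∗B descends
  -- to B with difference d.
  have main : ∀ U : Finset ℤ, 2 ≤ U.card → (∀ a ∈ U, ∀ b ∈ U, (2 : ℤ) ∣ a - b) →
      (U + V).card + 1 ≤ U.card + V.card → ∃ p d, d ≠ 0 ∧ B = arithProg p d B.card := by
    intro U hU hUU hle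
    obtain ⟨u, hu, u', hu', hlt, h⟩ := exists_forall_eq_arithProg hU
    obtain ⟨p, hp⟩ := h V hVn hle
    obtain ⟨d, hd⟩ := hUU u' hu' u hu
    rw [hd, hVc] at hp
    obtain ⟨q, hq⟩ := eq_arithProg_of_image_affine (X := B) ⟨x, hx⟩ (c := 2) (e := 0) two_ne_zero
      (by simpa [hV] using hp)
    exact ⟨q, d, by omega, hq⟩
  by_cases hU1 : 2 ≤ U₁.card
  · refine main U₁ hU1 ?_ (by omega)
    intro a ha b hb
    simp only [hU₁, Finset.mem_filter] at ha hb
    omega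
  by_cases hU2 : 2 ≤ U₂.card
  · refine main U₂ hU2 ?_ (by omega)
    intro a ha b hb
    simp only [hU₂, Finset.mem_filter] at ha hb
    omega
  · have := Finset.card_pos.2 h1
    have := Finset.card_pos.2 h2
    have hB2 : B.card = 2 := by omega
    obtain ⟨r, s, hrs, rfl⟩ := Finset.card_eq_two.1 hB2
    exact ⟨r, s - r, by omega, by rw [hB2]; exact pair_eq_arithProg r s⟩

theorem sumDilate_two {A : Finset ℤ} (hA : A.Nonempty) :
    3 * A.card ≤ (sumDilate 2 A).card + 2 ∧
      ((sumDilate 2 A).card + 2 = 3 * A.card ↔ IsArithProg A) := by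
  have hlow : 3 * A.card ≤ (sumDilate 2 A).card + 2 ∧
      ((sumDilate 2 A).card + 2 ≤ 3 * A.card → IsArithProg A) := by
    by_cases h2 : 2 ≤ A.card
    · obtain ⟨c, e, B, hc, rfl, hB⟩ := exists_affine_not_dvd_sub (n := 2) (by decide) h2
      rw [card_sumDilate_image_affine 2 hc, card_image_affine hc]
      obtain ⟨h1, h3⟩ := sumDilate_two_of_not_dvd_sub hB
      refine ⟨h1, fun h => ?_⟩
      obtain ⟨p, d, hd, hp⟩ := h3 h
      have hpos : 0 < B.card := by
        obtain ⟨x, hx, -⟩ := hB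
        exact Finset.card_pos.2 ⟨x, hx⟩
      refine ⟨c * p + e, c * d, B.card, mul_ne_zero hc hd, hpos, ?_⟩
      conv_lhs => rw [hp]
      exact arithProg_image_affine ..
    · have := Finset.card_pos.2 hA
      obtain ⟨x, rfl⟩ := Finset.card_eq_one.1 (by omega : A.card = 1)
      refine ⟨by simp [sumDilate], fun _ => ⟨x, 1, 1, one_ne_zero, le_rfl, by simp⟩⟩
  refine ⟨hlow.1, fun h => hlow.2 h.le, ?_⟩
  rintro ⟨a, d, k, hd, hk, hAk⟩
  change A = arithProg a d k at hAk
  -- The coefficients i + 2 j with i, j < k do not exceed 3 k - 3.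
  have hsub : sumDilate 2 A ⊆ arithProg (3 * a) d (3 * k - 2) := by
    intro z hz
    simp only [mem_sumDilate, hAk, mem_arithProg] at hz ⊢
    obtain ⟨_, ⟨i, hi, rfl⟩, _, ⟨j, hj, rfl⟩, rfl⟩ := hz
    exact ⟨i + 2 * j, by omega, by push_cast; ring⟩
  have := Finset.card_le_card hsub
  rw [card_arithProg _ hd] at this
  have hc : A.card = k := by rw [hAk, card_arithProg _ hd]
  omega

/-! ### Residue classes modulo 3 -/

/-- The elements of `X` congruent to `r` modulo `3`. -/
def cls (X : Finset ℤ) (r : ℤ) : Finset ℤ := X.filter fun x => (3 : ℤ) ∣ x - r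

theorem mem_cls {X : Finset ℤ} {r x : ℤ} : x ∈ cls X r ↔ x ∈ X ∧ (3 : ℤ) ∣ x - r := by
  simp [cls]

theorem cls_congr (X : Finset ℤ) {r s : ℤ} (h : (3 : ℤ) ∣ r - s) : cls X r = cls X s := by
  ext x
  simp only [mem_cls]
  constructor <;> rintro ⟨h1, h2⟩ <;> exact ⟨h1, by omega⟩

theorem card_eq_cls (X : Finset ℤ) (e : ℤ) :
    X.card = (cls X e).card + (cls X (e + 1)).card + (cls X (e + 2)).card := by
  rw [← Finset.card_union_of_disjoint, ← Finset.card_union_of_disjoint]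
  · congr 1
    ext x
    simp only [Finset.mem_union, mem_cls]
    constructor
    · intro h
      by_cases h1 : (3 : ℤ) ∣ x - e
      · exact Or.inl (Or.inl ⟨h, h1⟩)
      by_cases h2 : (3 : ℤ) ∣ x - (e + 1)
      · exact Or.inl (Or.inr ⟨h, h2⟩)
      · exact Or.inr ⟨h, by omega⟩
    · tauto
  · rw [Finset.disjoint_left]
    intro x
    simp only [Finset.mem_union, mem_cls]
    rintro (⟨-, h⟩ | ⟨-, h⟩) ⟨-, h'⟩ <;> omega
  · rw [Finset.disjoint_left]
    intro x
    simp only [mem_cls]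
    rintro ⟨-, h⟩ ⟨-, h'⟩
    omega

theorem cls_add_subset {X V R : Finset ℤ} (h : X + V ⊆ R) {e : ℤ}
    (hV : ∀ v ∈ V, (3 : ℤ) ∣ v - e) {r t : ℤ} (hrt : (3 : ℤ) ∣ r + e - t) :
    cls X r + V ⊆ cls R t := by
  intro z hz
  obtain ⟨x, hx, v, hv, rfl⟩ := Finset.mem_add.1 hz
  obtain ⟨hx, hxr⟩ := mem_cls.1 hx
  have := hV v hv
  exact mem_cls.2 ⟨h (Finset.add_mem_add hx hv), by omega⟩

theorem card_cls_add_card_le {X V R : Finset ℤ} (hVn : V.Nonempty) (h : X + V ⊆ R) {e : ℤ}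
    (hV : ∀ v ∈ V, (3 : ℤ) ∣ v - e) {r t : ℤ} (hrt : (3 : ℤ) ∣ r + e - t)
    (hr : 0 < (cls X r).card) :
    (cls X r).card + V.card ≤ (cls R t).card + 1 := by
  have h1 := card_add_card_le (Finset.card_pos.1 hr) hVn
  have h2 := Finset.card_le_card (cls_add_subset h hV hrt)
  omega

/-- As V lies in one class, the three classes of X have sums with V in three different classes; each
loses at most 1. -/
theorem card_add_three_mul_card_le {X V : Finset ℤ} (hVn : V.Nonempty) {e : ℤ}
    (hV : ∀ v ∈ V, (3 : ℤ) ∣ v - e) (hX : ∀ r, 0 < (cls X r).card) :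
    X.card + 3 * V.card ≤ (X + V).card + 3 := by
  have h0 := card_cls_add_card_le hVn subset_rfl hV (r := 0) (t := e) (by simp) (hX 0)
  have h1 := card_cls_add_card_le hVn subset_rfl hV (r := 1) (t := e + 1) (by omega) (hX 1)
  have h2 := card_cls_add_card_le hVn subset_rfl hV (r := 2) (t := e + 2) (by omega) (hX 2)
  have := card_eq_cls X 0
  have := card_eq_cls (X + V) e
  simp only [zero_add] at *
  omega

/-! ### Lower bounds for sets meeting two classes modulo 3 -/

/-- The set `3 ∗ X ∪ (3 ∗ Y + 1)`. -/
def interleave (X Y : Finset ℤ) : Finset ℤ := X.image (3 * ·) ∪ Y.image fun y => 3 * y + 1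

theorem card_image_three_mul (X : Finset ℤ) : (X.image ((3 : ℤ) * ·)).card = X.card :=
  Finset.card_image_of_injective _ (mul_right_injective₀ three_ne_zero)

theorem card_image_three_mul_add (X : Finset ℤ) (e : ℤ) :
    (X.image fun x => 3 * x + e).card = X.card :=
  card_image_affine three_ne_zero e X

theorem card_interleave (X Y : Finset ℤ) : (interleave X Y).card = X.card + Y.card := by
  rw [interleave, Finset.card_union_of_disjoint, card_image_three_mul, card_image_three_mul_add]
  rw [Finset.disjoint_left]
  intro z hz hz'
  obtain ⟨x, -, rfl⟩ := Finset.mem_image.1 hz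
  obtain ⟨y, -, hy⟩ := Finset.mem_image.1 hz'
  omega

/-- With B = 3∗X ∪ (3∗Y + 1), the sums split modulo 3 as B + 3∗B = 3∗(X + B) ∪ (3∗(Y + B) + 1). -/
theorem card_sumDilate_interleave (X Y : Finset ℤ) :
    (sumDilate 3 (interleave X Y)).card =
      (X + interleave X Y).card + (Y + interleave X Y).card := by
  rw [← card_interleave]
  congr 1
  ext z
  simp only [mem_sumDilate, interleave, Finset.mem_union, Finset.mem_image, Finset.mem_add]
  constructor
  · rintro ⟨_, ⟨x, hx, rfl⟩ | ⟨y, hy, rfl⟩, b, hb, rfl⟩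
    · exact Or.inl ⟨x + b, ⟨x, hx, b, hb, rfl⟩, by ring⟩
    · exact Or.inr ⟨y + b, ⟨y, hy, b, hb, rfl⟩, by ring⟩
  · rintro (⟨_, ⟨x, hx, b, hb, rfl⟩, rfl⟩ | ⟨_, ⟨y, hy, b, hb, rfl⟩, rfl⟩)
    · exact ⟨_, Or.inl ⟨x, hx, rfl⟩, b, hb, by ring⟩
    · exact ⟨_, Or.inr ⟨y, hy, rfl⟩, b, hb, by ring⟩

/-- The reflection z ↦ 1 - z exchanges the roles of X and Y, so bounds for |X + B| also serve for |Y
+ B|. -/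
theorem card_add_interleave_reflect (X Y : Finset ℤ) :
    (-Y + interleave (-Y) (-X)).card = (Y + interleave X Y).card := by
  have h : -Y + interleave (-Y) (-X) = (Y + interleave X Y).image fun z => -1 * z + 1 := by
    ext z
    simp only [interleave, Finset.mem_union, Finset.mem_image, Finset.mem_add, Finset.mem_neg]
    constructor
    · rintro ⟨_, ⟨y, hy, rfl⟩, _, ⟨_, ⟨y', hy', rfl⟩, rfl⟩ | ⟨_, ⟨x, hx, rfl⟩, rfl⟩, rfl⟩
      · exact ⟨_, ⟨y, hy, _, Or.inr ⟨y', hy', rfl⟩, rfl⟩, by ring⟩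
      · exact ⟨_, ⟨y, hy, _, Or.inl ⟨x, hx, rfl⟩, rfl⟩, by ring⟩
    · rintro ⟨_, ⟨y, hy, _, ⟨x, hx, rfl⟩ | ⟨y', hy', rfl⟩, rfl⟩, rfl⟩
      · exact ⟨_, ⟨y, hy, rfl⟩, _, Or.inr ⟨_, ⟨x, hx, rfl⟩, rfl⟩, by ring⟩
      · exact ⟨_, ⟨y, hy, rfl⟩, _, Or.inl ⟨_, ⟨y', hy', rfl⟩, rfl⟩, by ring⟩
  rw [h, card_image_affine (by norm_num)]

theorem card_sumDilate_neg (n : ℤ) (X : Finset ℤ) :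
    (sumDilate n (-X)).card = (sumDilate n X).card := by
  rw [← card_sumDilate_image_affine n (c := -1) (by norm_num) 0 X]
  congr 2
  ext z
  simp only [Finset.mem_neg, Finset.mem_image]
  exact exists_congr fun a => and_congr_right fun _ => by omega

theorem dvd_of_mem_image_three_mul {X : Finset ℤ} :
    ∀ v ∈ X.image ((3 : ℤ) * ·), (3 : ℤ) ∣ v - 0 := by
  intro v hv
  obtain ⟨x, -, rfl⟩ := Finset.mem_image.1 hv
  simp

theorem dvd_of_mem_image_three_mul_add {X : Finset ℤ} :
    ∀ v ∈ X.image (fun x => 3 * x + 1), (3 : ℤ) ∣ v - 1 := by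
  intro v hv
  obtain ⟨x, -, rfl⟩ := Finset.mem_image.1 hv
  simp

theorem sumDilate_subset_add_interleave (X Y : Finset ℤ) :
    X + X.image ((3 : ℤ) * ·) ⊆ X + interleave X Y :=
  Finset.add_subset_add_left Finset.subset_union_left

theorem add_image_subset_add_interleave (X Y : Finset ℤ) :
    X + Y.image (fun y => 3 * y + 1) ⊆ X + interleave X Y :=
  Finset.add_subset_add_left Finset.subset_union_right

/-- The least elements 4 m and m + 3 m' + 1 would coincide, which fails modulo 3. -/
theorem add_image_three_mul_ne {X Y : Finset ℤ} (hX : X.Nonempty) (hY : Y.Nonempty) :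
    X + X.image ((3 : ℤ) * ·) ≠ X + Y.image fun y => 3 * y + 1 := by
  intro h
  set m := X.min' hX
  set m' := Y.min' hY
  have h1 : m + 3 * m ∈ X + Y.image fun y => 3 * y + 1 := by
    rw [← h]
    exact Finset.add_mem_add (X.min'_mem hX) (Finset.mem_image_of_mem _ (X.min'_mem hX))
  have h2 : m + (3 * m' + 1) ∈ X + X.image ((3 : ℤ) * ·) := by
    rw [h]
    exact Finset.add_mem_add (X.min'_mem hX)
      (Finset.mem_image_of_mem (fun y => 3 * y + 1) (Y.min'_mem hY))
  simp only [Finset.mem_add, Finset.mem_image] at h1 h2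
  obtain ⟨x, hx, _, ⟨y, hy, rfl⟩, h1⟩ := h1
  obtain ⟨x', hx', _, ⟨y', hy', rfl⟩, h2⟩ := h2
  have := X.min'_le _ hx
  have := X.min'_le _ hx'
  have := Y.min'_le _ hy
  have := X.min'_le _ hy'
  omega

/-- Lower bounds for the classes modulo `3` of `X + (3 ∗ X ∪ (3 ∗ Y + 1))`. -/
theorem cls_bounds {X Y : Finset ℤ} (hX : X.Nonempty) (hY : Y.Nonempty) {r t : ℤ}
    (hrt : (3 : ℤ) ∣ r + 1 - t) :
    (cls (X + X.image ((3 : ℤ) * ·)) r).card ≤ (cls (X + interleave X Y) r).card ∧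
    (0 < (cls X r).card →
      (cls X r).card + X.card ≤ (cls (X + X.image ((3 : ℤ) * ·)) r).card + 1) ∧
    (0 < (cls X r).card → (cls X r).card + Y.card ≤ (cls (X + interleave X Y) t).card + 1) ∧
    ((cls X r).card = 0 → (cls (X + X.image ((3 : ℤ) * ·)) r).card = 0) := by
  refine ⟨Finset.card_le_card (Finset.filter_subset_filter _ (sumDilate_subset_add_interleave X Y)),
    fun h => ?_, fun h => ?_, fun h => ?_⟩
  · have := card_cls_add_card_le (hX.image _) subset_rfl dvd_of_mem_image_three_mul (r := r)
      (t := r) (by simp) h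
    rwa [card_image_three_mul] at this
  · have := card_cls_add_card_le (hY.image _) (add_image_subset_add_interleave X Y)
      dvd_of_mem_image_three_mul_add hrt h
    rwa [card_image_three_mul_add] at this
  · rw [Finset.card_eq_zero, Finset.eq_empty_iff_forall_notMem] at h ⊢
    intro z hz
    obtain ⟨hz, hzr⟩ := mem_cls.1 hz
    simp only [Finset.mem_add, Finset.mem_image] at hz
    obtain ⟨x, hx, _, ⟨y, hy, rfl⟩, rfl⟩ := hz
    exact h x (mem_cls.2 ⟨hx, by omega⟩)

theorem cls_card_pos {X : Finset ℤ} (h0 : 0 < (cls X 0).card) (h1 : 0 < (cls X 1).card)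
    (h2 : 0 < (cls X 2).card) (r : ℤ) : 0 < (cls X r).card := by
  have : (3 : ℤ) ∣ r - 0 ∨ (3 : ℤ) ∣ r - 1 ∨ (3 : ℤ) ∣ r - 2 := by omega
  rcases this with h | h | h <;> rw [cls_congr X h] <;> assumption

/-- Lower bounds for `|X + (3 ∗ X ∪ (3 ∗ Y + 1))|` according to the number of classes modulo `3`
that `X` meets. -/
theorem card_add_interleave_bounds {X Y : Finset ℤ} (hX : X.Nonempty) (hY : Y.Nonempty)
    (hP : 4 * X.card ≤ (sumDilate 3 X).card + 4) :
    (5 * X.card + Y.card ≤ (X + interleave X Y).card + 5 ∧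
      (X.card = 1 → Y.card + 1 ≤ (X + interleave X Y).card)) ∨
    (∃ q, 1 ≤ q ∧ q < X.card ∧ 4 * X.card + Y.card + q ≤ (X + interleave X Y).card + 5 ∧
      3 * X.card + 2 * Y.card ≤ (X + interleave X Y).card + 3 + q) ∨
    ((∀ r, 0 < (cls X r).card) ∧ 3 ≤ X.card ∧ 4 * X.card ≤ (X + interleave X Y).card + 3 ∧
      X.card + 3 * Y.card ≤ (X + interleave X Y).card + 3 ∧
      (X.card = Y.card → 4 * X.card ≤ (X + interleave X Y).card + 2)) := by
  obtain ⟨a0, b0, d0, e0⟩ := cls_bounds hX hY (r := 0) (t := 1) (by norm_num)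
  obtain ⟨a1, b1, d1, e1⟩ := cls_bounds hX hY (r := 1) (t := 2) (by norm_num)
  obtain ⟨a2, b2, d2, e2⟩ := cls_bounds hX hY (r := 2) (t := 0) (by norm_num)
  have hXc := card_eq_cls X 0
  have hPc := card_eq_cls (X + X.image ((3 : ℤ) * ·)) 0
  have hRc := card_eq_cls (X + interleave X Y) 0
  simp only [zero_add] at hXc hPc hRc
  have hP' : 4 * X.card ≤ (X + X.image ((3 : ℤ) * ·)).card + 4 := hP
  have hx := Finset.card_pos.2 hX
  have hy := Finset.card_pos.2 hY
  by_cases hall : 0 < (cls X 0).card ∧ 0 < (cls X 1).card ∧ 0 < (cls X 2).card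
  · right; right
    obtain ⟨h0, h1, h2⟩ := hall
    have hpos := cls_card_pos h0 h1 h2
    have hPl := card_add_three_mul_card_le (hX.image _) dvd_of_mem_image_three_mul hpos
    have hQl := card_add_three_mul_card_le (hY.image _) dvd_of_mem_image_three_mul_add hpos
    rw [card_image_three_mul] at hPl
    rw [card_image_three_mul_add] at hQl
    have hPR := Finset.card_le_card (sumDilate_subset_add_interleave X Y)
    have hQR := Finset.card_le_card (add_image_subset_add_interleave X Y)
    refine ⟨hpos, by omega, by omega, by omega, fun hxy => ?_⟩
    -- Otherwise both X + 3∗X and X + (3∗Y + 1), of size at least 4|X| - 3, would fill the whole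
    -- sumset and be equal.
    by_contra! hlt
    apply add_image_three_mul_ne hX hY
    rw [Finset.eq_of_subset_of_card_le (sumDilate_subset_add_interleave X Y) (by omega),
      Finset.eq_of_subset_of_card_le (add_image_subset_add_interleave X Y) (by omega)]
  generalize (cls X 0).card = c0 at *
  generalize (cls X 1).card = c1 at *
  generalize (cls X 2).card = c2 at *
  -- If X meets exactly the classes r and r + 1, then class r + 2 misses X + 3∗X and receives only
  -- X_(r+1) + (3∗Y + 1); hence q is the size of X_(r+1).
  by_cases h01 : 0 < c0 ∧ 0 < c1
  · exact Or.inr (Or.inl ⟨c1, by omega, by omega, by omega, by omega⟩)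
  by_cases h12 : 0 < c1 ∧ 0 < c2
  · exact Or.inr (Or.inl ⟨c2, by omega, by omega, by omega, by omega⟩)
  by_cases h20 : 0 < c2 ∧ 0 < c0
  · exact Or.inr (Or.inl ⟨c0, by omega, by omega, by omega, by omega⟩)
  -- Here X lies in one class, so X + 3∗X and X + (3∗Y + 1) are disjoint. For |X| = 1 the inductive
  -- bound 4|X| - 4 = 0 is replaced by the true size 1.
  · left
    constructor
    · omega
    · omega

theorem card_sumDilate_interleave_bounds {X Y : Finset ℤ} (hX : X.Nonempty) (hY : Y.Nonempty)
    (hPX : 4 * X.card ≤ (sumDilate 3 X).card + 4) (hPY : 4 * Y.card ≤ (sumDilate 3 Y).card + 4) :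
    4 * (interleave X Y).card ≤ (sumDilate 3 (interleave X Y)).card + 4 ∧
    ((sumDilate 3 (interleave X Y)).card + 4 ≤ 4 * (interleave X Y).card →
      (interleave X Y).card = 2 ∨ (interleave X Y).card = 3 ∨
      (X.card = Y.card ∧ 2 ≤ X.card ∧ (X + interleave X Y).card + 2 ≤ 4 * X.card)) := by
  rw [card_interleave, card_sumDilate_interleave, ← card_add_interleave_reflect]
  have hx := Finset.card_pos.2 hX
  have hy := Finset.card_pos.2 hY
  have h1 := card_add_interleave_bounds hX hY hPX
  have h2 := card_add_interleave_bounds hY.neg hX.neg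
    (by rw [card_sumDilate_neg, Finset.card_neg]; exact hPY)
  rw [Finset.card_neg, Finset.card_neg] at h2
  generalize (X + interleave X Y).card = f at *
  generalize (-Y + interleave (-Y) (-X)).card = g at *
  rcases h1 with ⟨h1, h1'⟩ | ⟨q, hq1, hq2, hq3, hq4⟩ | ⟨-, l1, l2, l3, l4⟩ <;>
  rcases h2 with ⟨k1, k1'⟩ | ⟨p, hp1, hp2, hp3, hp4⟩ | ⟨-, k1, k2, k3, k4⟩ <;>
  constructor <;> omega

/-! ### Structure of X and Y when |X| = |Y| and |X + B| ≤ 4|X| - 2 -/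

theorem arithProg_diff_unique {p q d d' : ℤ} {k : ℕ} (hk : 2 ≤ k) (hd : 0 < d) (hd' : 0 < d')
    (h : arithProg p d k = arithProg q d' k) : d = d' := by
  have key : ∀ {p q d d' : ℤ}, 0 < d → 0 < d' → arithProg p d k = arithProg q d' k →
      q ≤ p ∧ p + ((k - 1 : ℕ) : ℤ) * d ≤ q + ((k - 1 : ℕ) : ℤ) * d' := by
    intro p q d d' hd hd' h
    have h0 : p ∈ arithProg q d' k := by
      rw [← h, mem_arithProg]
      exact ⟨0, by omega, by simp⟩
    have h1 : p + ((k - 1 : ℕ) : ℤ) * d ∈ arithProg q d' k := by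
      rw [← h, mem_arithProg]
      exact ⟨k - 1, by omega, rfl⟩
    rw [mem_arithProg] at h0 h1
    obtain ⟨i, -, hi⟩ := h0
    obtain ⟨j, hj, hj'⟩ := h1
    have h2 : 0 ≤ (i : ℤ) * d' := by positivity
    have h3 : (j : ℤ) * d' ≤ ((k - 1 : ℕ) : ℤ) * d' :=
      mul_le_mul_of_nonneg_right (by omega) hd'.le
    exact ⟨by omega, by omega⟩
  obtain ⟨a1, a2⟩ := key hd hd' h
  obtain ⟨b1, b2⟩ := key hd' hd h.symm
  have h3 : ((k - 1 : ℕ) : ℤ) * d = ((k - 1 : ℕ) : ℤ) * d' := by omega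
  exact mul_left_cancel₀ (by omega) h3

/-- A set gaining at most one element under a shift by D is a progression of difference |D|, and the
difference of a progression is unique up to sign. -/
theorem arithProg_shift {p d D : ℤ} {k : ℕ} (hk : 2 ≤ k) (hd : 0 < d) (hD : D ≠ 0)
    (h : (arithProg p d k ∪ (arithProg p d k).image (· + D)).card ≤ k + 1) :
    D = d ∨ D = -d := by
  have hc := card_arithProg p hd.ne' k
  have hne : (arithProg p d k).Nonempty := Finset.card_pos.1 (by omega)
  rcases lt_or_gt_of_ne hD with hD' | hD'
  · right
    have hcard : (arithProg p d k ∪ (arithProg p d k).image (· + -D)).card ≤ k + 1 := by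
      refine le_trans (le_of_eq ?_) h
      rw [← Finset.card_image_of_injective (arithProg p d k ∪ (arithProg p d k).image (· + D))
        (add_left_injective (-D)), Finset.image_union, Finset.image_image, Finset.union_comm]
      congr 2
      ext z
      simp
    obtain ⟨q, hq⟩ := eq_arithProg_of_card_union_le hne (by omega : 0 < -D) (by rwa [hc])
    rw [hc] at hq
    have := arithProg_diff_unique hk hd (by omega) hq
    omega
  · left
    obtain ⟨q, hq⟩ := eq_arithProg_of_card_union_le hne hD' (by rwa [hc])
    rw [hc] at hq
    exact (arithProg_diff_unique hk hd hD' hq).symm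

theorem eq_of_subset_of_card_le_both {U V W : Finset ℤ} (hU : U ⊆ W) (hV : V ⊆ W)
    (hWU : W.card ≤ U.card) (hWV : W.card ≤ V.card) : U = V :=
  (Finset.eq_of_subset_of_card_le hU hWU).trans (Finset.eq_of_subset_of_card_le hV hWV).symm

/-- Class t of the sumset contains both p + (3∗Y + 1) and q + 3∗X, each of size |X|; with no room
for more, they coincide. -/
theorem image_shift_of_cls_singleton {X Y : Finset ℤ} (hXY : X.card = Y.card) {p q r t : ℤ}
    (hp : cls X r = {p}) (hq : cls X t = {q}) (hrt : (3 : ℤ) ∣ r + 1 - t)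
    (hR : (cls (X + interleave X Y) t).card ≤ X.card) :
    Y.image (fun y => 3 * y + 1) = X.image fun x => 3 * x + (q - p) := by
  have h1 := cls_add_subset (add_image_subset_add_interleave X Y)
    dvd_of_mem_image_three_mul_add hrt
  have h2 := cls_add_subset (sumDilate_subset_add_interleave X Y) dvd_of_mem_image_three_mul
    (r := t) (t := t) (by simp)
  rw [hp] at h1
  rw [hq] at h2
  have h := eq_of_subset_of_card_le_both h1 h2
    (by rw [Finset.singleton_add, Finset.card_vadd_finset, card_image_three_mul_add]; omega)
    (by rw [Finset.singleton_add, Finset.card_vadd_finset, card_image_three_mul]; omega)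
  ext z
  have hz := Finset.ext_iff.1 h (p + z)
  simp only [Finset.mem_add, Finset.mem_singleton, Finset.mem_image, exists_eq_left,
    exists_exists_and_eq_and] at hz ⊢
  constructor
  · rintro ⟨y, hy, rfl⟩
    obtain ⟨x, hx, hxy⟩ := hz.1 ⟨y, hy, rfl⟩
    exact ⟨x, hx, by linarith⟩
  · rintro ⟨x, hx, rfl⟩
    obtain ⟨y, hy, hxy⟩ := hz.2 ⟨x, hx, by ring⟩
    exact ⟨y, hy, by linarith⟩

theorem shift_unique {X : Finset ℤ} (hX : X.Nonempty) {D D' : ℤ}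
    (h : X.image (fun x => 3 * x + D) = X.image fun x => 3 * x + D') : D = D' := by
  have key : ∀ {D D' : ℤ}, X.image (fun x => 3 * x + D) = X.image (fun x => 3 * x + D') →
      D' ≤ D := by
    intro D D' h
    have h1 : 3 * X.min' hX + D ∈ X.image fun x => 3 * x + D' := by
      rw [← h]
      exact Finset.mem_image_of_mem (fun x => 3 * x + D) (X.min'_mem hX)
    obtain ⟨x, hx, hx'⟩ := Finset.mem_image.1 h1
    have := X.min'_le _ hx
    omega
  exact le_antisymm (key h.symm) (key h)

theorem mem_of_cls_eq_singleton {X : Finset ℤ} {p r : ℤ} (h : cls X r = {p}) :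
    p ∈ X ∧ (3 : ℤ) ∣ p - r :=
  mem_cls.1 (h ▸ Finset.mem_singleton_self p)

/-- `X` is an arithmetic progression and `3 ∗ Y + 1` is a translate of `3 ∗ X` by plus or minus the
difference of `X`. -/
def IsShiftedProg (X Y : Finset ℤ) : Prop :=
  ∃ p d D : ℤ, d ≠ 0 ∧ (D = d ∨ D = -d) ∧ X = arithProg p d X.card ∧
    Y.image (fun y => 3 * y + 1) = X.image fun x => 3 * x + D

theorem isShiftedProg_of_card_two {X Y : Finset ℤ} (hXY : X.card = Y.card) (hX : X.card = 2)
    {r t : ℤ} (hr : (cls X r).card = 1) (ht : (cls X t).card = 1) (hrt : (3 : ℤ) ∣ r + 1 - t)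
    (hR : (cls (X + interleave X Y) t).card ≤ 2) : IsShiftedProg X Y := by
  obtain ⟨p, hp⟩ := Finset.card_eq_one.1 hr
  obtain ⟨q, hq⟩ := Finset.card_eq_one.1 ht
  obtain ⟨hpX, hpr⟩ := mem_of_cls_eq_singleton hp
  obtain ⟨hqX, hqt⟩ := mem_of_cls_eq_singleton hq
  have hpq : p ≠ q := by omega
  refine ⟨p, q - p, q - p, by omega, Or.inl rfl, ?_,
    image_shift_of_cls_singleton hXY hp hq hrt (by omega)⟩
  rw [hX, ← pair_eq_arithProg]
  symm
  apply Finset.eq_of_subset_of_card_le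
  · simp [Finset.insert_subset_iff, hpX, hqX]
  · rw [hX, Finset.card_pair hpq]

/-- The two tight classes give 3∗Y + 1 = 3∗X + (q - p) = 3∗X + (u - q), so p, q, u are in
progression. -/
theorem isShiftedProg_of_card_three {X Y : Finset ℤ} (hXY : X.card = Y.card) (hX : X.card = 3)
    {r s t : ℤ} (hr : (cls X r).card = 1) (hs : (cls X s).card = 1) (ht : (cls X t).card = 1)
    (hrs : (3 : ℤ) ∣ r + 1 - s) (hst : (3 : ℤ) ∣ s + 1 - t)
    (hRs : (cls (X + interleave X Y) s).card ≤ 3) (hRt : (cls (X + interleave X Y) t).card ≤ 3) :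
    IsShiftedProg X Y := by
  obtain ⟨p, hp⟩ := Finset.card_eq_one.1 hr
  obtain ⟨q, hq⟩ := Finset.card_eq_one.1 hs
  obtain ⟨u, hu⟩ := Finset.card_eq_one.1 ht
  obtain ⟨hpX, hpr⟩ := mem_of_cls_eq_singleton hp
  obtain ⟨hqX, hqs⟩ := mem_of_cls_eq_singleton hq
  obtain ⟨huX, hut⟩ := mem_of_cls_eq_singleton hu
  have h1 := image_shift_of_cls_singleton hXY hp hq hrs (by omega)
  have h2 := image_shift_of_cls_singleton hXY hq hu hst (by omega)
  have h3 := shift_unique ⟨p, hpX⟩ (h1.symm.trans h2)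
  have hpq : p ≠ q := by omega
  refine ⟨p, q - p, q - p, by omega, Or.inl rfl, ?_, h1⟩
  rw [hX]
  symm
  apply Finset.eq_of_subset_of_card_le
  · intro z hz
    obtain ⟨i, hi, rfl⟩ := mem_arithProg.1 hz
    interval_cases i
    · simpa using hpX
    · simpa using hqX
    · convert huX using 1
      push_cast
      linarith
  · rw [hX, card_arithProg _ (by omega)]

/-- Both 3∗X and 3∗Y + 1 have tight sums with the same class of X, so both are progressions of the
same difference 3 d. It remains to find the shift between them. -/
theorem isShiftedProg_of_tight_class {X Y : Finset ℤ} (hXY : X.card = Y.card) (hX : 3 ≤ X.card)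
    {r t : ℤ} (hr : 2 ≤ (cls X r).card) (hrt : (3 : ℤ) ∣ r + 1 - t)
    (hRr : (cls (X + interleave X Y) r).card + 1 ≤ (cls X r).card + X.card)
    (hRt : (cls (X + interleave X Y) t).card + 1 ≤ (cls X r).card + X.card)
    (hR : (X + interleave X Y).card + 2 ≤ 4 * X.card) : IsShiftedProg X Y := by
  have hXn : X.Nonempty := Finset.card_pos.1 (by omega)
  have hYn : Y.Nonempty := Finset.card_pos.1 (by omega)
  have h1 := Finset.card_le_card (cls_add_subset (add_image_subset_add_interleave X Y)
    dvd_of_mem_image_three_mul_add hrt)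
  have h2 := Finset.card_le_card (cls_add_subset (sumDilate_subset_add_interleave X Y)
    dvd_of_mem_image_three_mul (r := r) (t := r) (by simp))
  obtain ⟨u, hu, u', hu', hlt, h⟩ := exists_forall_eq_arithProg hr
  have hdvd := dvd_sub_sub (mem_cls.1 hu).2 (mem_cls.1 hu').2
  obtain ⟨d, hd⟩ := hdvd
  obtain ⟨p, hp⟩ := h _ (hXn.image _) (by rw [card_image_three_mul]; omega)
  obtain ⟨q, hq⟩ := h _ (hYn.image fun y => 3 * y + 1) (by rw [card_image_three_mul_add]; omega)
  rw [hd, card_image_three_mul] at hp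
  rw [hd, card_image_three_mul_add] at hq
  obtain ⟨p, hp⟩ := eq_arithProg_of_image_affine (e := 0) hXn three_ne_zero (by simpa using hp)
  obtain ⟨q, hq⟩ := eq_arithProg_of_image_affine hYn three_ne_zero hq
  have hY3 : Y.image (fun y => 3 * y + 1) = X.image fun x => 3 * x + (3 * q + 1 - 3 * p) := by
    rw [hp, hq, ← hXY, arithProg_image_affine, arithProg_image_affine]
    congr 1
    ring
  -- As |X| ≥ 3, the numbers i + 3 j with 0 ≤ i, j < |X| cover 0, …, 4|X| - 4.
  have hsub : arithProg (4 * p) d (4 * X.card - 3) ⊆ X + X.image ((3 : ℤ) * ·) := by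
    intro z hz
    obtain ⟨n, hn, rfl⟩ := mem_arithProg.1 hz
    have hmem : ∀ i < X.card, p + (i : ℤ) * d ∈ X := fun i hi =>
      (Finset.ext_iff.1 hp _).2 (mem_arithProg.2 ⟨i, hi, rfl⟩)
    obtain ⟨i, j, hi, hj, rfl⟩ : ∃ i j : ℕ, i < X.card ∧ j < X.card ∧ n = i + 3 * j := by
      by_cases hnx : n / 3 < X.card
      · exact ⟨n % 3, n / 3, by omega, hnx, by omega⟩
      · exact ⟨n - 3 * (X.card - 1), X.card - 1, by omega, by omega, by omega⟩
    refine Finset.mem_add.2 ⟨_, hmem i hi, _, Finset.mem_image_of_mem _ (hmem j hj), ?_⟩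
    push_cast
    ring
  have hshift : X + Y.image (fun y => 3 * y + 1) =
      (X + X.image ((3 : ℤ) * ·)).image (· + (3 * q + 1 - 3 * p)) := by
    rw [hY3]
    ext z
    simp only [Finset.mem_add, Finset.mem_image]
    constructor
    · rintro ⟨x, hx, _, ⟨x', hx', rfl⟩, rfl⟩
      exact ⟨_, ⟨x, hx, _, ⟨x', hx', rfl⟩, rfl⟩, by ring⟩
    · rintro ⟨_, ⟨x, hx, _, ⟨x', hx', rfl⟩, rfl⟩, rfl⟩
      exact ⟨x, hx, _, ⟨x', hx', rfl⟩, by ring⟩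
  have hunion : arithProg (4 * p) d (4 * X.card - 3) ∪
      (arithProg (4 * p) d (4 * X.card - 3)).image (· + (3 * q + 1 - 3 * p)) ⊆
      X + interleave X Y :=
    Finset.union_subset (hsub.trans (sumDilate_subset_add_interleave X Y))
      ((Finset.image_subset_image hsub).trans
        (hshift ▸ add_image_subset_add_interleave X Y))
  have hle := Finset.card_le_card hunion
  -- The shift is 1 modulo 3, hence nonzero, and only one element beyond the progression is
  -- available.
  have := arithProg_shift (by omega) (by omega) (by omega) (hle.trans (by omega))
  exact ⟨p, d, 3 * q + 1 - 3 * p, by omega, this, hp, hY3⟩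

theorem isShiftedProg_of_card_le {X Y : Finset ℤ} (hXY : X.card = Y.card) (hX : 2 ≤ X.card)
    (hP : 4 * X.card ≤ (sumDilate 3 X).card + 4)
    (hR : (X + interleave X Y).card + 2 ≤ 4 * X.card) : IsShiftedProg X Y := by
  have hXn : X.Nonempty := Finset.card_pos.1 (by omega)
  have hYn : Y.Nonempty := Finset.card_pos.1 (by omega)
  obtain ⟨a0, b0, d0, e0⟩ := cls_bounds hXn hYn (r := 0) (t := 1) (by norm_num)
  obtain ⟨a1, b1, d1, e1⟩ := cls_bounds hXn hYn (r := 1) (t := 2) (by norm_num)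
  obtain ⟨a2, b2, d2, e2⟩ := cls_bounds hXn hYn (r := 2) (t := 0) (by norm_num)
  have hXc := card_eq_cls X 0
  have hRc := card_eq_cls (X + interleave X Y) 0
  simp only [zero_add] at hXc hRc
  rcases card_add_interleave_bounds hXn hYn hP with
    ⟨h, -⟩ | ⟨k, hk1, hk2, hk3, hk4⟩ | ⟨hpos, h3, -, -, -⟩
  · omega
  -- With |Y| = |X| the third bound becomes |X| + k ≤ 3.
  · have hX2 : X.card = 2 := by omega
    by_cases h0 : (cls X 0).card = 1 ∧ (cls X 1).card = 1
    · exact isShiftedProg_of_card_two hXY hX2 h0.1 h0.2 (by norm_num) (by omega)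
    by_cases h1 : (cls X 1).card = 1 ∧ (cls X 2).card = 1
    · exact isShiftedProg_of_card_two hXY hX2 h1.1 h1.2 (by norm_num) (by omega)
    by_cases h2 : (cls X 2).card = 1 ∧ (cls X 0).card = 1
    · exact isShiftedProg_of_card_two hXY hX2 h2.1 h2.2 (by norm_num) (by omega)
    have hPc := card_eq_cls (X + X.image ((3 : ℤ) * ·)) 0
    simp only [zero_add] at hPc
    have hP' : 4 * X.card ≤ (X + X.image ((3 : ℤ) * ·)).card + 4 := hP
    omega
  have p0 := hpos 0
  have p1 := hpos 1
  have p2 := hpos 2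
  by_cases hX3 : X.card = 3
  · have h0 : (cls X 0).card = 1 := by omega
    have h1 : (cls X 1).card = 1 := by omega
    have h2 : (cls X 2).card = 1 := by omega
    -- Each class of the sumset has at least 3 elements and there are at most 10 in all, so at most
    -- one class exceeds 3.
    by_cases k0 : (cls (X + interleave X Y) 0).card ≤ 3
    · by_cases k1 : (cls (X + interleave X Y) 1).card ≤ 3
      · exact isShiftedProg_of_card_three hXY hX3 h2 h0 h1 (by norm_num) (by norm_num) k0 k1
      · exact isShiftedProg_of_card_three hXY hX3 h1 h2 h0 (by norm_num) (by norm_num)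
          (by omega) k0
    · exact isShiftedProg_of_card_three hXY hX3 h0 h1 h2 (by norm_num) (by norm_num)
        (by omega) (by omega)
  -- Class t of the sumset has at least |X| - 1 plus the larger of the sizes of classes t and t - 1
  -- of X. Summing over t, the largest minus the smallest class of X, plus the total excess over
  -- these bounds, is at most 1. Since |X| ≥ 4, some class r with at least two elements is then
  -- tight at both r and r + 1.
  · by_cases k0 : 2 ≤ (cls X 0).card ∧
        (cls (X + interleave X Y) 0).card + 1 ≤ (cls X 0).card + X.card ∧
        (cls (X + interleave X Y) 1).card + 1 ≤ (cls X 0).card + X.card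
    · exact isShiftedProg_of_tight_class hXY h3 k0.1 (by norm_num) k0.2.1 k0.2.2 hR
    by_cases k1 : 2 ≤ (cls X 1).card ∧
        (cls (X + interleave X Y) 1).card + 1 ≤ (cls X 1).card + X.card ∧
        (cls (X + interleave X Y) 2).card + 1 ≤ (cls X 1).card + X.card
    · exact isShiftedProg_of_tight_class hXY h3 k1.1 (by norm_num) k1.2.1 k1.2.2 hR
    by_cases k2 : 2 ≤ (cls X 2).card ∧
        (cls (X + interleave X Y) 2).card + 1 ≤ (cls X 2).card + X.card ∧
        (cls (X + interleave X Y) 0).card + 1 ≤ (cls X 2).card + X.card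
    · exact isShiftedProg_of_tight_class hXY h3 k2.1 (by norm_num) k2.2.1 k2.2.2 hR
    omega

/-! ### The lower bound for n = 3 -/

theorem sumDilate_three_strict {B : Finset ℤ} (hpos : ∀ r, 0 < (cls B r).card) :
    4 * B.card ≤ (sumDilate 3 B).card + 3 := by
  obtain ⟨x, hx⟩ := Finset.card_pos.1 (hpos 0)
  have := card_add_three_mul_card_le (Finset.Nonempty.image ⟨x, (mem_cls.1 hx).1⟩ (3 * ·))
    (dvd_of_mem_image_three_mul (X := B)) hpos
  rw [card_image_three_mul] at this
  change _ ≤ (sumDilate 3 B).card + 3 at this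
  omega

theorem exists_eq_interleave {B : Finset ℤ} (hB : ∃ x ∈ B, ∃ y ∈ B, ¬ (3 : ℤ) ∣ x - y) {r : ℤ}
    (hr : cls B r = ∅) :
    ∃ (e : ℤ) (X Y : Finset ℤ), X.Nonempty ∧ Y.Nonempty ∧
      B = (interleave X Y).image fun z => 1 * z + e := by
  have hr' : ∀ z ∈ B, ¬ (3 : ℤ) ∣ z - r := fun z hz h =>
    Finset.notMem_empty z (hr ▸ mem_cls.2 ⟨hz, h⟩)
  have key : ∃ x ∈ B, ∃ y ∈ B, (3 : ℤ) ∣ x - (r + 1) ∧ (3 : ℤ) ∣ y - (r + 2) := by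
    obtain ⟨x, hx, y, hy, hxy⟩ := hB
    have := hr' x hx
    have := hr' y hy
    by_cases h : (3 : ℤ) ∣ x - (r + 1)
    · exact ⟨x, hx, y, hy, h, by omega⟩
    · exact ⟨y, hy, x, hx, by omega, by omega⟩
  obtain ⟨x, hx, y, hy, hxr, hyr⟩ := key
  refine ⟨r + 1, (cls B (r + 1)).image fun z => (z - (r + 1)) / 3,
    (cls B (r + 2)).image fun z => (z - (r + 2)) / 3,
    Finset.Nonempty.image ⟨x, mem_cls.2 ⟨hx, hxr⟩⟩ _,
    Finset.Nonempty.image ⟨y, mem_cls.2 ⟨hy, hyr⟩⟩ _, ?_⟩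
  ext z
  simp only [interleave, Finset.mem_image, Finset.mem_union, mem_cls]
  constructor
  · intro hz
    have := hr' z hz
    by_cases h : (3 : ℤ) ∣ z - (r + 1)
    · exact ⟨_, Or.inl ⟨_, ⟨z, ⟨hz, h⟩, rfl⟩, rfl⟩, by omega⟩
    · exact ⟨_, Or.inr ⟨_, ⟨z, ⟨hz, by omega⟩, rfl⟩, rfl⟩, by omega⟩
  · rintro ⟨_, ⟨_, ⟨w, ⟨hw, hwr⟩, rfl⟩, rfl⟩ | ⟨_, ⟨w, ⟨hw, hwr⟩, rfl⟩, rfl⟩, rfl⟩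
    · convert hw using 1
      omega
    · convert hw using 1
      omega

theorem isAffineTransform_image {A C : Finset ℤ} {c : ℤ} (hc : c ≠ 0) (e : ℤ)
    (h : IsAffineTransform A C) : IsAffineTransform (A.image fun x => c * x + e) C := by
  obtain ⟨c', e', hc', rfl⟩ := h
  refine ⟨c * c', c * e' + e, mul_ne_zero hc hc', ?_⟩
  rw [Finset.image_image]
  congr 1
  ext x
  simp only [Function.comp]
  ring

/-- A set of at least two integers is, up to an affine map, of the form `3 ∗ X ∪ (3 ∗ Y + 1)`,
unless a representative of it meets all classes modulo `3`. -/
theorem exists_affine_interleave {A : Finset ℤ} (hA : 2 ≤ A.card) :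
    4 * A.card ≤ (sumDilate 3 A).card + 3 ∨
    ∃ (c e : ℤ) (X Y : Finset ℤ), c ≠ 0 ∧ X.Nonempty ∧ Y.Nonempty ∧
      A = (interleave X Y).image fun z => c * z + e := by
  obtain ⟨c, e, B, hc, rfl, hB⟩ := exists_affine_not_dvd_sub (n := 3) (by decide) hA
  by_cases hpos : ∀ r, 0 < (cls B r).card
  · left
    rw [card_image_affine hc, card_sumDilate_image_affine 3 hc]
    exact sumDilate_three_strict hpos
  · right
    push Not at hpos
    obtain ⟨r, hr⟩ := hpos
    obtain ⟨e', X, Y, hX, hY, rfl⟩ :=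
      exists_eq_interleave hB (Finset.card_eq_zero.1 (Nat.le_zero.1 hr))
    refine ⟨c, c * e' + e, X, Y, hc, hX, hY, ?_⟩
    rw [Finset.image_image]
    congr 1
    ext z
    simp only [Function.comp]
    ring

/-- Induction on |A|: both X and Y are nonempty, hence smaller than A. -/
theorem four_mul_card_le (A : Finset ℤ) : 4 * A.card ≤ (sumDilate 3 A).card + 4 := by
  induction hn : A.card using Nat.strong_induction_on generalizing A with
  | _ n ih =>
    subst hn
    by_cases h2 : 2 ≤ A.card
    · rcases exists_affine_interleave h2 with h | ⟨c, e, X, Y, hc, hX, hY, rfl⟩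
      · omega
      · rw [card_image_affine hc, card_interleave] at ih
        rw [card_image_affine hc, card_sumDilate_image_affine 3 hc]
        have := Finset.card_pos.2 hX
        have := Finset.card_pos.2 hY
        exact (card_sumDilate_interleave_bounds hX hY (ih _ (by omega) X rfl)
          (ih _ (by omega) Y rfl)).1
    · omega

/-! ### The extremal sets for n = 3 -/

theorem isAffineTransform_of_subset {A : Finset ℤ} {c e x y z : ℤ} (hc : c ≠ 0)
    (hA : A.card ≤ ({x, y, z} : Finset ℤ).card) (hx : c * x + e ∈ A) (hy : c * y + e ∈ A)
    (hz : c * z + e ∈ A) : IsAffineTransform A {x, y, z} := by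
  refine ⟨c, e, hc, (Finset.eq_of_subset_of_card_le ?_ ?_).symm⟩
  · simp [Finset.insert_subset_iff, hx, hy, hz]
  · rwa [card_image_affine hc]

/-- Nine pairs have at most eight sums, so a - b = 3 (b' - a') for two distinct pairs. Among three
elements, some member of {a, b} equals one of {a', b'}, and each coincidence fixes the shape of A.
-/
theorem isAffineTransform_of_card_three {A : Finset ℤ} (hA : A.card = 3)
    (h : (sumDilate 3 A).card ≤ 8) :
    IsAffineTransform A {0, 1, 3} ∨ IsAffineTransform A {0, 1, 4} := by
  obtain ⟨⟨a, a'⟩, ha, ⟨b, b'⟩, hb, hne, hab⟩ := Finset.exists_ne_map_eq_of_card_lt_of_maps_to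
    (s := A ×ˢ A) (t := sumDilate 3 A) (f := fun p => p.1 + 3 * p.2)
    (by rw [Finset.card_product, hA]; omega)
    (fun p hp => by
      obtain ⟨h1, h2⟩ := Finset.mem_product.1 hp
      exact mem_sumDilate.2 ⟨_, h1, _, h2, rfl⟩)
  simp only [Finset.mem_product] at ha hb
  obtain ⟨ha, ha'⟩ := ha
  obtain ⟨hb, hb'⟩ := hb
  simp only at hab
  have hd : b' - a' ≠ 0 := by
    intro h0
    exact hne (Prod.ext (by simp only; omega) (by simp only; omega))
  have h013 : A.card ≤ ({0, 1, 3} : Finset ℤ).card := by rw [hA]; decide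
  have h014 : A.card ≤ ({0, 1, 4} : Finset ℤ).card := by rw [hA]; decide
  have mem {w w' : ℤ} (hw : w ∈ A) (h : w = w') : w' ∈ A := h ▸ hw
  by_cases h1 : a' = b
  · exact Or.inl (isAffineTransform_of_subset (e := b) hd h013 (mem hb (by ring))
      (mem hb' (by omega)) (mem ha (by omega)))
  by_cases h2 : b' = b
  · exact Or.inr (isAffineTransform_of_subset (e := a') hd h014 (mem ha' (by ring))
      (mem hb (by omega)) (mem ha (by omega)))
  by_cases h3 : a' = a
  · exact Or.inr (isAffineTransform_of_subset (e := b') (neg_ne_zero.2 hd) h014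
      (mem hb' (by ring)) (mem ha (by omega)) (mem hb (by omega)))
  by_cases h4 : b' = a
  · exact Or.inl (isAffineTransform_of_subset (e := a) (neg_ne_zero.2 hd) h013
      (mem ha (by ring)) (mem ha' (by omega)) (mem hb (by omega)))
  · exfalso
    have hsub : ({a, b, a', b'} : Finset ℤ) ⊆ A := by
      simp [Finset.insert_subset_iff, ha, hb, ha', hb']
    have hcard : ({a, b, a', b'} : Finset ℤ).card = 4 := by
      have hab' : a ≠ b := by omega
      have hd' : a' ≠ b' := by omega
      rw [Finset.card_insert_of_notMem, Finset.card_insert_of_notMem, Finset.card_pair hd']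
      · simp [Ne.symm h1, Ne.symm h2]
      · simp [hab', Ne.symm h3, Ne.symm h4]
    have := Finset.card_le_card hsub
    omega

theorem mem_threeDilateUnion {n : ℕ} {z : ℤ} :
    z ∈ threeDilateUnion n ↔ ∃ i ≤ n, 3 * (i : ℤ) = z ∨ 3 * (i : ℤ) + 1 = z := by
  simp only [threeDilateUnion, Finset.mem_union, Finset.mem_image, Finset.mem_range,
    Nat.lt_succ_iff]
  constructor
  · rintro (⟨i, hi, h⟩ | ⟨i, hi, h⟩)
    exacts [⟨i, hi, Or.inl h⟩, ⟨i, hi, Or.inr h⟩]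
  · rintro ⟨i, hi, h | h⟩
    exacts [Or.inl ⟨i, hi, h⟩, Or.inr ⟨i, hi, h⟩]

theorem threeDilateUnion_eq_interleave (n : ℕ) :
    threeDilateUnion n = interleave (arithProg 0 1 (n + 1)) (arithProg 0 1 (n + 1)) := by
  simp [threeDilateUnion, interleave, arithProg, Finset.image_image, Function.comp_def]

theorem card_threeDilateUnion (n : ℕ) : (threeDilateUnion n).card = 2 * (n + 1) := by
  rw [threeDilateUnion_eq_interleave, card_interleave, card_arithProg _ one_ne_zero]
  ring

theorem card_sumDilate_threeDilateUnion_le (n : ℕ) :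
    (sumDilate 3 (threeDilateUnion n)).card ≤ 8 * n + 4 := by
  -- Here (3 i + ε) + 3 (3 j + δ) = 3 (i + 3 j + δ) + ε, with index at most 4 n + 1.
  have hsub : sumDilate 3 (threeDilateUnion n) ⊆ threeDilateUnion (4 * n + 1) := by
    intro z hz
    simp only [mem_sumDilate, mem_threeDilateUnion] at hz ⊢
    obtain ⟨x, ⟨i, hi, hx⟩, y, ⟨j, hj, hy⟩, rfl⟩ := hz
    rcases hy with hy | hy
    · exact ⟨i + 3 * j, by omega, by push_cast; omega⟩
    · exact ⟨i + 3 * j + 1, by omega, by push_cast; omega⟩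
  have := Finset.card_le_card hsub
  rw [card_threeDilateUnion] at this
  omega

theorem isAffineTransform_of_isShiftedProg {X Y : Finset ℤ} (hX : X.Nonempty)
    (h : IsShiftedProg X Y) : ∃ n : ℕ, IsAffineTransform (interleave X Y) (threeDilateUnion n) := by
  obtain ⟨p, d, D, hd, hD, hXp, hY⟩ := h
  have hpos := Finset.card_pos.2 hX
  have hmem : ∀ x, x ∈ X ↔ ∃ i ≤ X.card - 1, p + (i : ℕ) * d = x := by
    intro x
    rw [Finset.ext_iff.1 hXp x, mem_arithProg]
    exact exists_congr fun i => and_congr_left fun _ => by omega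
  -- If D = -d the block 3∗Y + 1 plays the role of the multiples of 3, so the origin moves to 3 p -
  -- d.
  refine ⟨X.card - 1, d, if D = d then 3 * p else 3 * p - d, hd, ?_⟩
  ext z
  rw [interleave, hY]
  simp only [Finset.mem_union, Finset.mem_image, mem_threeDilateUnion, hmem]
  split_ifs with hDd
  · subst hDd
    constructor
    · rintro (⟨_, ⟨i, hi, rfl⟩, rfl⟩ | ⟨_, ⟨i, hi, rfl⟩, rfl⟩)
      · exact ⟨_, ⟨i, hi, Or.inl rfl⟩, by ring⟩
      · exact ⟨_, ⟨i, hi, Or.inr rfl⟩, by ring⟩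
    · rintro ⟨_, ⟨i, hi, rfl | rfl⟩, rfl⟩
      · exact Or.inl ⟨_, ⟨i, hi, rfl⟩, by ring⟩
      · exact Or.inr ⟨_, ⟨i, hi, rfl⟩, by ring⟩
  · obtain rfl : D = -d := hD.resolve_left hDd
    constructor
    · rintro (⟨_, ⟨i, hi, rfl⟩, rfl⟩ | ⟨_, ⟨i, hi, rfl⟩, rfl⟩)
      · exact ⟨_, ⟨i, hi, Or.inr rfl⟩, by ring⟩
      · exact ⟨_, ⟨i, hi, Or.inl rfl⟩, by ring⟩
    · rintro ⟨_, ⟨i, hi, rfl | rfl⟩, rfl⟩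
      · exact Or.inr ⟨_, ⟨i, hi, rfl⟩, by ring⟩
      · exact Or.inl ⟨_, ⟨i, hi, rfl⟩, by ring⟩

theorem isAffineTransform_of_card_two {A : Finset ℤ} (hA : A.card = 2) :
    IsAffineTransform A (threeDilateUnion 0) := by
  obtain ⟨x, y, hxy, rfl⟩ := Finset.card_eq_two.1 hA
  refine ⟨y - x, x, by omega, ?_⟩
  simp [threeDilateUnion]

theorem isAffineTransform_of_card_sumDilate_le {A : Finset ℤ}
    (h : (sumDilate 3 A).card + 4 ≤ 4 * A.card) :
    IsAffineTransform A {0, 1, 3} ∨ IsAffineTransform A {0, 1, 4} ∨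
      ∃ n : ℕ, IsAffineTransform A (threeDilateUnion n) := by
  by_cases hA2 : A.card = 2
  · exact Or.inr (Or.inr ⟨0, isAffineTransform_of_card_two hA2⟩)
  by_cases hA3 : A.card = 3
  · rcases isAffineTransform_of_card_three hA3 (by omega) with h | h
    exacts [Or.inl h, Or.inr (Or.inl h)]
  have hne : 2 ≤ A.card := by
    by_contra! hlt
    have h1 : A.card = 1 := by omega
    obtain ⟨x, rfl⟩ := Finset.card_eq_one.1 h1
    simp [sumDilate] at h
  rcases exists_affine_interleave hne with h' | ⟨c, e, X, Y, hc, hX, hY, rfl⟩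
  · omega
  rw [card_image_affine hc, card_sumDilate_image_affine 3 hc] at h
  rw [card_image_affine hc] at hA2 hA3
  rcases (card_sumDilate_interleave_bounds hX hY (four_mul_card_le X) (four_mul_card_le Y)).2 h
    with h2 | h3 | ⟨hXY, hX2, hR⟩
  · exact absurd h2 hA2
  · exact absurd h3 hA3
  obtain ⟨n, hn⟩ := isAffineTransform_of_isShiftedProg hX
    (isShiftedProg_of_card_le hXY hX2 (four_mul_card_le X) hR)
  exact Or.inr (Or.inr ⟨n, isAffineTransform_image hc e hn⟩)

theorem card_sumDilate_of_isAffineTransform {A : Finset ℤ}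
    (h : IsAffineTransform A {0, 1, 3} ∨ IsAffineTransform A {0, 1, 4} ∨
      ∃ n : ℕ, IsAffineTransform A (threeDilateUnion n)) :
    (sumDilate 3 A).card + 4 ≤ 4 * A.card := by
  rcases h with ⟨c, e, hc, rfl⟩ | ⟨c, e, hc, rfl⟩ | ⟨n, c, e, hc, rfl⟩ <;>
    rw [card_image_affine hc, card_sumDilate_image_affine 3 hc]
  · decide
  · decide
  · have := card_sumDilate_threeDilateUnion_le n
    rw [card_threeDilateUnion]
    omega

end BaumslagSolitar

/-! ### The theorem -/

open BaumslagSolitar in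
theorem theorem2p1 (A : Finset ℤ) :
    (∀ S : Set (BS 1 2), S = BS.bPowSet 1 2 A →
      3 * (S.ncard : ℤ) - 2 ≤ ((S * S).ncard : ℤ) ∧
      (((S * S).ncard : ℤ) = 3 * (S.ncard : ℤ) - 2 ↔ IsArithProg A)) ∧
    (∀ S : Set (BS 1 3), S = BS.bPowSet 1 3 A →
      4 * (S.ncard : ℤ) - 4 ≤ ((S * S).ncard : ℤ) ∧
      (((S * S).ncard : ℤ) = 4 * (S.ncard : ℤ) - 4 ↔
        IsAffineTransform A {0, 1, 3} ∨ IsAffineTransform A {0, 1, 4} ∨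
          ∃ n : ℕ, IsAffineTransform A (threeDilateUnion n))) := by
  constructor
  · rintro S rfl
    rw [ncard_bPowSet_mul_self 2 two_ne_zero, ncard_bPowSet 2 two_ne_zero]
    rcases A.eq_empty_or_nonempty with rfl | hA
    -- For A empty the bound is -2 < 0, and a progression has k ≥ 1 terms, so both sides of the
    -- equivalence fail.
    · refine ⟨by simp, fun h => ?_, ?_⟩
      · simp [sumDilate] at h
      · rintro ⟨a, d, k, -, hk, h⟩
        have := congrArg Finset.Nonempty h
        simp at this
        omega
    · obtain ⟨h1, h2⟩ := sumDilate_two hA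
      exact ⟨by omega, fun h => h2.1 (by omega), fun h => by have := h2.2 h; omega⟩
  · rintro S rfl
    rw [ncard_bPowSet_mul_self 3 three_ne_zero, ncard_bPowSet 3 three_ne_zero]
    have h1 := four_mul_card_le A
    exact ⟨by omega, fun h => isAffineTransform_of_card_sumDilate_le (by omega),
      fun h => by have := card_sumDilate_of_isAffineTransform h; omega⟩
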